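/- Let $\Omega=\prod_{j=1}^p[z_j^{\mathrm L},z_j^{\mathrm U}]\subset\mathbb R^p$ be a box, let $k:\Omega\times\Omega\to\mathbb R$ be a continuous positive semidefinite kernel (for instance the Matérn-$5/2$ kernel), and let $\mathcal H_k$ be its reproducing kernel Hilbert space, with norm $\|\cdot\|_k$. Let $r,g_1,\dots,g_q:\Omega\to\mathbb R$ be mutually independent random functions on a probability space (deterministic functions are allowed). Consider the black-box problem $$\text{minimize } r(\mathbf z)\ \text{ over } \mathbf z\in\Omega\quad\text{subject to } g_i(\mathbf z)\le 0,\ i=1,\dots,q. \tag{1}$$ Suppose that the exact values of $r,g_1,\dots,g_q$ are observed at $N\ge1$ (possibly random) points $\mathbf z^1,\dots,\mathbf z^N\in\Omega$ whose covariance matrix $K=(k(\mathbf z^a,\mathbf z^b))_{a,b}$ is almost surely invertible. With $\mathbf k^*(\mathbf z)=(k(\mathbf z^a,\mathbf z))_a$, the noise-free Gaussian process model of a function $f$ with constant (possibly random) prior mean $m$ has predictive mean and standard deviation $$\mu(\mathbf z)=m+\mathbf k^*(\mathbf z)^\top K^{-1}\big(f(\mathbf z^a)-m\big)_{a},\qquad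 \sigma(\mathbf z)=\big(k(\mathbf z,\mathbf z)-\mathbf k^*(\mathbf z)^\top K^{-1}\mathbf k^*(\mathbf z)\big)^{1/2}.$$ Write $\mu_r,\sigma_r$ for the model of $r$ with prior mean $m_r$, and $\mu_g^i,\sigma_g^i$ for the model of $g_i$ with prior mean $m_i$. Assume that, for every $i$, the centred constraint $g_i-m_i$ (that is, $g_i$ itself for the zero prior mean) almost surely belongs to $\mathcal H_k$, and so has finite norm $\|g_i-m_i\|_k$. Let $\delta\in(0,1)$, $\beta_r>0$, and $$\bar\beta_N^i=\Big(2\|g_i-m_i\|_k^2+300\,\gamma_N^i\ln^3\tfrac N\delta\Big)^{1/2},\qquad \gamma_N^i=\sup_{a_1,\dots,a_N\in\Omega}\tfrac12\ln\det\big(I+\lambda_i^{-1}(k(a_s,a_t))_{s,t}\big),$$ where $\gamma_N^i$ is the maximum information gain, taken with an arbitrary reference noise variance $\lambda_i>0$. Then, with probability at least $(1-\delta)^q$, every optimal solution of the pessimistic constrained lower-confidence-bound problem $$\text{minimize } \mu_r(\mathbf z)-\beta_r\sigma_r(\mathbf z)\ \text{ over } \mathbf z\in\Omega\quad\text{subject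 to } \mu_g^i(\mathbf z)+\bar\beta_N^i\,\sigma_g^i(\mathbf z)\le 0,\ i=1,\dots,q,$$ is feasible for problem (1). -/

import Mathlib

open MeasureTheory ProbabilityTheory

namespace SafeBO

/-! ### Gaussian process regression with noise-free observations -/

/-- The covariance matrix `K` of the sample points `Z`. -/
def covMatrix {X : Type*} {N : ℕ} (k : X → X → ℝ) (Z : Fin N → X) : Matrix (Fin N) (Fin N) ℝ :=
  Matrix.of fun a b => k (Z a) (Z b)

/-- The covariance vector `k*` between the sample points `Z` and a candidate `z`. -/
def crossCov {X : Type*} {N : ℕ} (k : X → X → ℝ) (Z : Fin N → X) (z : X) : Fin N → ℝ :=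
  fun a => k (Z a) z

/-- The predictive mean `m + k*ᵀ K⁻¹ (f(z¹) - m, …, f(zᴺ) - m)` of the Gaussian process with constant
prior mean `m` and kernel `k`, given the exact values of `f` at the sample points `Z`. -/
noncomputable def postMean {X : Type*} {N : ℕ} (k : X → X → ℝ) (m : ℝ) (Z : Fin N → X)
    (f : X → ℝ) (z : X) : ℝ :=
  m + dotProduct (crossCov k Z z) (Matrix.mulVec (covMatrix k Z)⁻¹ fun a => f (Z a) - m)

/-- The predictive variance `k(z,z) - k*ᵀ K⁻¹ k*`. -/
noncomputable def postVar {X : Type*} {N : ℕ} (k : X → X → ℝ) (Z : Fin N → X) (z : X) : ℝ :=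
  k z z - dotProduct (crossCov k Z z) (Matrix.mulVec (covMatrix k Z)⁻¹ (crossCov k Z z))

/-- The predictive standard deviation. -/
noncomputable def postStd {X : Type*} {N : ℕ} (k : X → X → ℝ) (Z : Fin N → X) (z : X) : ℝ :=
  Real.sqrt (postVar k Z z)

/-- The lower confidence bound acquisition function of `f`. -/
noncomputable def lcb {X : Type*} {N : ℕ} (k : X → X → ℝ) (m : ℝ) (Z : Fin N → X)
    (f : X → ℝ) (β : ℝ) (z : X) : ℝ :=
  postMean k m Z f z - β * postStd k Z z

/-! ### Maximum information gain -/

/-- The mutual information between a centred Gaussian process with kernel `k` and its observations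
at the points `A` under Gaussian noise of variance `lam`. -/
noncomputable def infoGain {X : Type*} {N : ℕ} (k : X → X → ℝ) (lam : ℝ) (A : Fin N → X) : ℝ :=
  1 / 2 * Real.log (1 + lam⁻¹ • covMatrix k A).det

/-- The maximum information gain `γ_N` of `N` observations. -/
noncomputable def maxInfoGain {X : Type*} (k : X → X → ℝ) (lam : ℝ) (N : ℕ) : ℝ :=
  sSup (Set.range fun A : Fin N → X => infoGain k lam A)

/-! ### The norm of a function in a reproducing kernel Hilbert space -/

/-- The function `f` belongs to the reproducing kernel Hilbert space `H`. -/
def InRKHS {X : Type*} (H : Type*) [NormedAddCommGroup H] [InnerProductSpace ℝ H]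
    [RKHS ℝ H X ℝ] (f : X → ℝ) : Prop :=
  ∃ h : H, ⇑h = f

open Classical in
/-- The norm of `f` in `H`, that is, the norm of the only element of `H` that is `f` as a
function. The value `0` off `H` is never used. -/
noncomputable def rkhsNorm {X : Type*} (H : Type*) [NormedAddCommGroup H] [InnerProductSpace ℝ H]
    [RKHS ℝ H X ℝ] (f : X → ℝ) : ℝ :=
  if hf : ∃ h : H, ⇑h = f then ‖hf.choose‖ else 0

/-- The width `(2 B² + 300 γ ln³(N/δ))^(1/2)` of the confidence interval after `N` observations, for
a function of norm `B` and maximum information gain `γ`. -/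
noncomputable def confWidth (B γ : ℝ) (N : ℕ) (δ : ℝ) : ℝ :=
  Real.sqrt (2 * B ^ 2 + 300 * γ * Real.log (N / δ) ^ 3)

/-! ### Constrained minimization -/

/-- The points that satisfy all constraints `c i z ≤ 0`. -/
def feasibleSet {X : Type*} {q : ℕ} (c : Fin q → X → ℝ) : Set X :=
  {z | ∀ i, c i z ≤ 0}

/-- `z` is an optimal solution of: minimize `F` subject to `c i ≤ 0` for all `i`. -/
def IsOptimalSolution {X : Type*} {q : ℕ} (F : X → ℝ) (c : Fin q → X → ℝ) (z : X) : Prop :=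
  z ∈ feasibleSet c ∧ IsMinOn F (feasibleSet c) z

/-- The pessimistic estimate `μ + β̄ σ` of a constraint `f`, where the norm in `β̄` is that of the
centred constraint `f - m`. -/
noncomputable def pessimistic {X : Type*} {N : ℕ} (H : Type*) [NormedAddCommGroup H]
    [InnerProductSpace ℝ H] [RKHS ℝ H X ℝ] (k : X → X → ℝ) (lam δ m : ℝ) (Z : Fin N → X)
    (f : X → ℝ) (z : X) : ℝ :=
  postMean k m Z f z +
    confWidth (rkhsNorm H fun x => f x - m) (maxInfoGain k lam N) N δ * postStd k Z z

end SafeBO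

/-!
The confidence band of the predictive mean is valid path by path, so the event in question has
probability one. By the reproducing property, evaluation at `z` minus its kriging predictor
`h ↦ ∑ a, c a * h (Z a)`, with `c = K⁻¹ k*(z)`, is the inner product with
`kerFun z - ∑ a, c a • kerFun (Z a)`, whose squared norm is exactly the predictive variance.
Cauchy–Schwarz then gives `|f z - μ z| ≤ ‖f - m‖ σ z` (`abs_sub_postMean_le`).

The width of the confidence interval dominates the norm (`le_confWidth`): the information gain is
half the logarithm of `det (1 + λ⁻¹ K)`, which is at least `1` for positive semidefinite `K`
(`Matrix.PosSemidef.one_le_det_one_add`), and `log (N / δ) ≥ 0`. Hence every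
constraint lies below its pessimistic estimate whenever `K` is invertible and the centred
constraint has finite norm, which happens almost surely, and pessimistic feasibility implies
feasibility.
-/

open scoped InnerProductSpace

/-- The determinant is the product of the eigenvalues of `1 + A`, all at least `1`. -/
lemma Matrix.PosSemidef.one_le_det_one_add {n : Type*} [Fintype n] [DecidableEq n]
    {A : Matrix n n ℝ} (hA : A.PosSemidef) : 1 ≤ (1 + A).det := by
  -- `det (1 + A)` is, up to sign, the characteristic polynomial of `A` at `-1`.
  have h := A.eval_charpoly (-1)
  rw [hA.isHermitian.charpoly_eq, Polynomial.eval_prod] at h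
  have h2 : Matrix.scalar n (-1 : ℝ) - A = -(1 + A) := by
    rw [map_neg, map_one]; abel
  rw [h2, Matrix.det_neg] at h
  have h3 : (1 + A).det = ∏ i, (1 + hA.isHermitian.eigenvalues i) := by
    have hs : ((-1 : ℝ) ^ Fintype.card n) * (-1) ^ Fintype.card n = 1 := by
      rw [← mul_pow]; simp
    calc (1 + A).det
        = (-1) ^ Fintype.card n * ((-1) ^ Fintype.card n * (1 + A).det) := by
          rw [← mul_assoc, hs, one_mul]
      _ = ∏ i, (1 + hA.isHermitian.eigenvalues i) := by
          rw [← h, ← Finset.card_univ, ← Finset.prod_const, ← Finset.prod_mul_distrib]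
          refine Finset.prod_congr rfl fun i _ => ?_
          simp
          ring
  rw [h3]
  refine Finset.prod_induction _ (fun x : ℝ => 1 ≤ x) (fun _ _ => one_le_mul_of_one_le_of_one_le)
    le_rfl fun i _ => ?_
  linarith [hA.eigenvalues_nonneg i]

namespace SafeBO

section RKHS

variable {X H : Type*} {N : ℕ} {k : X → X → ℝ} [NormedAddCommGroup H] [InnerProductSpace ℝ H]
  [CompleteSpace H] [RKHS ℝ H X ℝ]

lemma inner_kerFun_one (hkH : ∀ x y, RKHS.kernel H x y 1 = k x y) (x y : X) :
    ⟪RKHS.kerFun H x 1, RKHS.kerFun H y 1⟫_ℝ = k x y := by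
  rw [RKHS.kerFun_inner, RKHS.kerFun_apply, hkH]
  simp

lemma kernel_symm (hkH : ∀ x y, RKHS.kernel H x y 1 = k x y) (x y : X) : k x y = k y x := by
  rw [← inner_kerFun_one hkH, real_inner_comm, inner_kerFun_one hkH]

/-- The covariance matrix is the Gram matrix of the kernel functions of the sample points. -/
lemma posSemidef_covMatrix (hkH : ∀ x y, RKHS.kernel H x y 1 = k x y) (Z : Fin N → X) :
    (covMatrix k Z).PosSemidef := by
  have h : covMatrix k Z = Matrix.gram ℝ fun a => RKHS.kerFun H (Z a) 1 := by
    ext a b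
    rw [Matrix.gram_apply, inner_kerFun_one hkH, covMatrix, Matrix.of_apply]
  rw [h]
  exact Matrix.posSemidef_gram ..

lemma infoGain_nonneg (hkH : ∀ x y, RKHS.kernel H x y 1 = k x y) {lam : ℝ} (hlam : 0 < lam)
    (A : Fin N → X) : 0 ≤ infoGain k lam A :=
  mul_nonneg (by norm_num) <| Real.log_nonneg <|
    ((posSemidef_covMatrix hkH A).smul (inv_nonneg.2 hlam.le)).one_le_det_one_add

/-- A supremum of nonnegative numbers is nonnegative; whether the range is bounded, as it is for a
continuous kernel on a compact set, does not matter for the sign. -/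
lemma maxInfoGain_nonneg (hkH : ∀ x y, RKHS.kernel H x y 1 = k x y) {lam : ℝ} (hlam : 0 < lam) :
    0 ≤ maxInfoGain k lam N := by
  refine Real.sSup_nonneg ?_
  rintro _ ⟨A, rfl⟩
  exact infoGain_nonneg hkH hlam A

/-- The predictive variance is the squared distance in `H` between the kernel function of `z` and
its kriging approximation in the span of the kernel functions of the sample points. -/
lemma norm_sq_kerFun_sub_sum (hkH : ∀ x y, RKHS.kernel H x y 1 = k x y) {Z : Fin N → X}
    (hZ : IsUnit (covMatrix k Z).det) (z : X) :
    ‖RKHS.kerFun H z 1 -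
      ∑ a, ((covMatrix k Z)⁻¹.mulVec (crossCov k Z z)) a • RKHS.kerFun H (Z a) 1‖ ^ 2 =
      postVar k Z z := by
  set c := (covMatrix k Z)⁻¹.mulVec (crossCov k Z z) with hc
  have hKc : (covMatrix k Z).mulVec c = crossCov k Z z := by
    rw [hc, Matrix.mulVec_mulVec, Matrix.mul_nonsing_inv _ hZ, Matrix.one_mulVec]
  have h1 : ⟪RKHS.kerFun H z 1, ∑ a, c a • RKHS.kerFun H (Z a) 1⟫_ℝ =
      dotProduct (crossCov k Z z) c := by
    simp only [inner_sum, real_inner_smul_right, inner_kerFun_one hkH, dotProduct, crossCov]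
    exact Finset.sum_congr rfl fun a _ => by rw [kernel_symm hkH, mul_comm]
  have h2 : ‖∑ a, c a • RKHS.kerFun H (Z a) 1‖ ^ 2 = dotProduct (crossCov k Z z) c := by
    rw [← hKc, ← real_inner_self_eq_norm_sq]
    simp only [sum_inner, inner_sum, real_inner_smul_left, real_inner_smul_right,
      inner_kerFun_one hkH, dotProduct, Matrix.mulVec, covMatrix, Matrix.of_apply,
      Finset.sum_mul]
    refine Finset.sum_congr rfl fun a _ => Finset.sum_congr rfl fun b _ => ?_
    rw [kernel_symm hkH (Z b)]
    ring
  rw [norm_sub_sq_real, h1, h2, ← real_inner_self_eq_norm_sq, inner_kerFun_one hkH, postVar]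
  ring

/-- The deterministic confidence band of the predictive mean of a function of finite norm. -/
lemma abs_sub_postMean_le (hkH : ∀ x y, RKHS.kernel H x y 1 = k x y) {Z : Fin N → X}
    (hZ : IsUnit (covMatrix k Z).det) {f : X → ℝ} {m : ℝ} {h : H}
    (hh : ⇑h = fun x => f x - m) (z : X) :
    |f z - postMean k m Z f z| ≤ ‖h‖ * postStd k Z z := by
  set c := (covMatrix k Z)⁻¹.mulVec (crossCov k Z z) with hc
  have hsymm : (covMatrix k Z)⁻¹.transpose = (covMatrix k Z)⁻¹ := by
    rw [Matrix.transpose_nonsing_inv]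
    congr 1
    ext a b
    exact kernel_symm hkH _ _
  have hmean : postMean k m Z f z = m + ∑ a, c a * h (Z a) := by
    rw [postMean, hh, Matrix.dotProduct_mulVec, ← Matrix.mulVec_transpose, hsymm, ← hc]
    rfl
  have hin : f z - postMean k m Z f z =
      ⟪RKHS.kerFun H z 1 - ∑ a, c a • RKHS.kerFun H (Z a) 1, h⟫_ℝ := by
    rw [hmean, inner_sub_left, sum_inner]
    simp only [real_inner_smul_left, RKHS.kerFun_inner]
    simp [congrFun hh z, sub_sub]
  rw [hin, mul_comm, postStd, ← norm_sq_kerFun_sub_sum hkH hZ z, Real.sqrt_sq (norm_nonneg _)]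
  exact abs_real_inner_le_norm _ _

end RKHS

lemma le_confWidth {B γ δ : ℝ} {N : ℕ} (hγ : 0 ≤ γ) (hN : 0 < N) (hδ0 : 0 < δ) (hδ1 : δ ≤ 1) :
    B ≤ confWidth B γ N δ := by
  refine Real.le_sqrt_of_sq_le ?_
  have hN1 : (1 : ℝ) ≤ N := by exact_mod_cast hN
  have hlog : 0 ≤ Real.log (N / δ) :=
    Real.log_nonneg ((one_le_div hδ0).2 (hδ1.trans hN1))
  have : 0 ≤ 300 * γ * Real.log (N / δ) ^ 3 := by positivity
  nlinarith [sq_nonneg B]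

/-- The pessimistic estimate is an upper bound of the constraint. -/
lemma le_pessimistic {X H : Type*} {N : ℕ} {k : X → X → ℝ} [NormedAddCommGroup H]
    [InnerProductSpace ℝ H] [CompleteSpace H] [RKHS ℝ H X ℝ]
    (hkH : ∀ x y, RKHS.kernel H x y 1 = k x y) (hN : 0 < N) {Z : Fin N → X}
    (hZ : IsUnit (covMatrix k Z).det) {lam δ m : ℝ} (hlam : 0 < lam) (hδ0 : 0 < δ) (hδ1 : δ ≤ 1)
    {f : X → ℝ} (hf : InRKHS H fun x => f x - m) (z : X) :
    f z ≤ pessimistic H k lam δ m Z f z := by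
  have hnorm : rkhsNorm H (fun x => f x - m) = ‖hf.choose‖ := dif_pos hf
  have hband := (le_abs_self _).trans (abs_sub_postMean_le hkH hZ hf.choose_spec z)
  have hwidth : ‖hf.choose‖ * postStd k Z z ≤
      confWidth (rkhsNorm H fun x => f x - m) (maxInfoGain k lam N) N δ * postStd k Z z := by
    rw [hnorm]
    exact mul_le_mul_of_nonneg_right
      (le_confWidth (maxInfoGain_nonneg hkH hlam) hN hδ0 hδ1) (Real.sqrt_nonneg _)
  rw [pessimistic]
  linarith

end SafeBO

theorem proposition1 {p q N : ℕ} (hN : 0 < N) (zL zU : Fin p → ℝ)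
    -- the kernel on the box, and its reproducing kernel Hilbert space
    (k : Set.Icc zL zU → Set.Icc zL zU → ℝ) (hk : Continuous (Function.uncurry k))
    (H : Type*) [NormedAddCommGroup H] [InnerProductSpace ℝ H] [CompleteSpace H]
    [RKHS ℝ H (Set.Icc zL zU) ℝ] (hkH : ∀ x y, RKHS.kernel H x y 1 = k x y)
    -- the unknown objective and constraints
    {W : Type*} [MeasurableSpace W] (P : Measure W) [IsProbabilityMeasure P]
    (r : W → Set.Icc zL zU → ℝ) (g : Fin q → W → Set.Icc zL zU → ℝ)
    (hr : Measurable r) (hg : ∀ i, Measurable (g i))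
    (hindep : iIndepFun (fun j : Option (Fin q) => j.elim r g) P)
    -- the sample points, and the constant prior means
    (Z : W → Fin N → Set.Icc zL zU) (hZ : ∀ᵐ w ∂P, IsUnit (SafeBO.covMatrix k (Z w)).det)
    (mr : W → ℝ) (m : Fin q → W → ℝ)
    (hgH : ∀ i, ∀ᵐ w ∂P, SafeBO.InRKHS H fun z => g i w z - m i w)
    -- the parameters of the confidence bounds
    (lam : Fin q → ℝ) (hlam : ∀ i, 0 < lam i) (βr : ℝ) (hβr : 0 < βr)
    (δ : ℝ) (hδ0 : 0 < δ) (hδ1 : δ < 1) :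
    ∃ E : Set W, MeasurableSet E ∧ ENNReal.ofReal ((1 - δ) ^ q) ≤ P E ∧
      ∀ w ∈ E, ∀ z : Set.Icc zL zU,
        SafeBO.IsOptimalSolution (SafeBO.lcb k (mr w) (Z w) (r w) βr)
          (fun i => SafeBO.pessimistic H k (lam i) δ (m i w) (Z w) (g i w)) z →
        z ∈ SafeBO.feasibleSet fun i => g i w := by
  obtain ⟨E, hE, hEm, hE0⟩ : ∃ E ⊆ {w | IsUnit (SafeBO.covMatrix k (Z w)).det ∧
      ∀ i, SafeBO.InRKHS H fun z => g i w z - m i w}, MeasurableSet E ∧ P E = 1 := by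
    have hae := hZ.and (ae_all_iff.2 hgH)
    obtain ⟨T, hT, hTm, hT0⟩ := exists_measurable_superset_of_null (mem_ae_iff.1 hae)
    exact ⟨Tᶜ, Set.compl_subset_comm.1 hT, hTm.compl, (prob_compl_eq_one_iff hTm).2 hT0⟩
  refine ⟨E, hEm, ?_, fun w hw z hz i => ?_⟩
  · rw [hE0, ENNReal.ofReal_le_one]
    exact pow_le_one₀ (by linarith) (by linarith)
  · exact (SafeBO.le_pessimistic hkH hN (hE hw).1 (hlam i) hδ0 hδ1.le ((hE hw).2 i) z).trans
      (hz.1 i)
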